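/- Let $F$ be a real vector lattice. A set $A\subset F$ is called an AM-set if it is solid (i.e. $f\in A$ and $|g|\le|f|$ imply $g\in A$) and $f\vee g\in A$ whenever $f,g\in A$ and $f,g\ge 0$. A linear topology on $F$ is called an AM-topology if it has a local base at $0$ consisting of AM-sets. Suppose that $F$ is endowed with a Hausdorff AM-topology which is also compactly generated (a set is closed whenever its intersection with every compact set is closed). Then $F$ embeds algebraically and topologically as a sublattice of $\mathcal{C}(X)$ for a Tychonoff space $X$, where $\mathcal{C}(X)$ denotes the vector lattice of continuous real-valued functions on $X$ with the compact-open topology. More precisely, let $X$ be the set of all continuous (linear) lattice homomorphisms $x:F\to\mathbb{R}$, regarded as a subspace of $\mathcal{C}(F)$ with the compact-open topology. Then $X$ is Tychonoff, and the evaluation map $J:F\to\mathcal{C}(X)$, $(Jf)(x):=x(f)$, is linear, preserves binary suprema and infima, and is a homeomorphism onto its image. -/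

import Mathlib

open Topology

/-- An AM-set in a vector lattice: a solid set that is closed under suprema of
its positive elements. -/
def IsAMSet {F : Type*} [AddCommGroup F] [Lattice F] (A : Set F) : Prop :=
  LatticeOrderedAddCommGroup.IsSolid A ∧
    ∀ ⦃f g : F⦄, f ∈ A → g ∈ A → 0 ≤ f → 0 ≤ g → f ⊔ g ∈ A

/-- An AM-topology on a vector lattice: a linear topology in which the
neighbourhoods of zero that are AM-sets form a local base at zero. -/
structure IsAMTopology (F : Type*) [AddCommGroup F] [Module ℝ F] [Lattice F]
    [TopologicalSpace F] : Prop where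
  isTopologicalAddGroup : IsTopologicalAddGroup F
  continuousSMul : ContinuousSMul ℝ F
  hasBasis : (𝓝 (0 : F)).HasBasis (fun A : Set F => A ∈ 𝓝 (0 : F) ∧ IsAMSet A) id

/-- The set of all continuous real-valued (linear) lattice homomorphisms on `F`, as a subset of
`C(F, ℝ)`. As a type it carries the subspace topology of the compact-open topology. -/
def contLatticeHoms (F : Type*) [AddCommGroup F] [Module ℝ F] [Lattice F]
    [TopologicalSpace F] : Set C(F, ℝ) :=
  {x | IsLinearMap ℝ x ∧ (∀ f g : F, x (f ⊔ g) = x f ⊔ x g) ∧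
    ∀ f g : F, x (f ⊓ g) = x f ⊓ x g}

/-- The evaluation map `F → C(X)`, `f ↦ (x ↦ x f)`, where `X` is the space of continuous
lattice homomorphisms on `F`. -/
def evalMap (F : Type*) [AddCommGroup F] [Module ℝ F] [Lattice F] [TopologicalSpace F]
    (f : F) : C(contLatticeHoms F, ℝ) where
  toFun x := x.1 f
  continuous_toFun := (continuous_eval_const f).comp continuous_subtype_val

/-! The gauge `ρ` of an AM-neighbourhood `A` is an M-seminorm: `ρ (f ⊔ g) ≤ max (ρ f) (ρ g)` for
positive `f`, `g`. The heart is `exists_latticeHom_eq`: `ρ` is attained at each positive `f` by a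
dominated lattice homomorphism, found as an extreme point `φ` of the compact set of supporting
functionals. By `component_mul_le`, every `0 ≤ ψ ≤ φ` rescales into that set, as does `φ - ψ`, so
extremality makes `ψ` a multiple of `φ`. Taking for `ψ` the component of `φ` along `h⁺` shows that
`φ` kills `h⁺` or `h⁻`.

The homomorphisms dominated by `ρ` form a compact subset `K` of `X`, so `ρ f` is the maximum of `|x
f|` over `K`. Hence `{f | |x f| < 1 on K} ⊆ A`, and the inverse of the evaluation map is continuous.
Compact generation is what makes the map itself continuous. -/

section VectorLattice

/-! ### M-seminorms and extreme supporting functionals -/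

variable {F : Type*} [AddCommGroup F] [Module ℝ F]

/-- Hahn–Banach for a nonnegative sublinear functional: it is attained at a given point by a
dominated linear functional. -/
theorem exists_linearMap_le_sublinear_eq (N : F → ℝ)
    (N_hom : ∀ c : ℝ, 0 < c → ∀ x, N (c • x) = c * N x)
    (N_add : ∀ x y, N (x + y) ≤ N x + N y) (N_nonneg : ∀ x, 0 ≤ N x) (x : F) :
    ∃ L : F →ₗ[ℝ] ℝ, L x = N x ∧ ∀ y, L y ≤ N y := by
  have N0 : N 0 = 0 := by
    have := N_hom 2 two_pos 0
    rw [smul_zero] at this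
    linarith
  have H : ∀ c : ℝ, c • x = 0 → c • N x = 0 := by
    intro c hc
    rcases smul_eq_zero.1 hc with rfl | rfl
    · simp
    · simp [N0]
  obtain ⟨L, hL, hle⟩ := exists_extension_of_le_sublinear
    (LinearPMap.mkSpanSingleton' (σ := RingHom.id ℝ) x (N x) H) N N_hom N_add (by
      rintro ⟨y, hy⟩
      obtain ⟨c, rfl⟩ := Submodule.mem_span_singleton.1 hy
      rw [LinearPMap.mkSpanSingleton'_apply]
      rcases le_or_gt c 0 with hc | hc
      · exact (mul_nonpos_of_nonpos_of_nonneg hc (N_nonneg x)).trans (N_nonneg _)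
      · exact (N_hom c hc x).ge)
  refine ⟨L, ?_, hle⟩
  exact (hL ⟨x, Submodule.mem_span_singleton_self x⟩).trans
    (LinearPMap.mkSpanSingleton'_apply_self x (N x) H _)

variable [Lattice F] [IsOrderedAddMonoid F] [IsOrderedModule ℝ F]

omit [IsOrderedAddMonoid F] in
theorem smul_sup_of_pos {c : ℝ} (hc : 0 < c) (x y : F) : c • (x ⊔ y) = c • x ⊔ c • y := by
  refine le_antisymm ?_ (sup_le (smul_le_smul_of_nonneg_left le_sup_left hc.le)
    (smul_le_smul_of_nonneg_left le_sup_right hc.le))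
  have h : x ⊔ y ≤ c⁻¹ • (c • x ⊔ c • y) := by
    refine sup_le ?_ ?_
    · have := smul_le_smul_of_nonneg_left (le_sup_left : c • x ≤ c • x ⊔ c • y) (inv_pos.2 hc).le
      rwa [inv_smul_smul₀ hc.ne'] at this
    · have := smul_le_smul_of_nonneg_left (le_sup_right : c • y ≤ c • x ⊔ c • y) (inv_pos.2 hc).le
      rwa [inv_smul_smul₀ hc.ne'] at this
  have := smul_le_smul_of_nonneg_left h hc.le
  rwa [smul_inv_smul₀ hc.ne'] at this

omit [IsOrderedAddMonoid F] in
theorem smul_inf_of_pos {c : ℝ} (hc : 0 < c) (x y : F) : c • (x ⊓ y) = c • x ⊓ c • y := by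
  refine le_antisymm (le_inf (smul_le_smul_of_nonneg_left inf_le_left hc.le)
    (smul_le_smul_of_nonneg_left inf_le_right hc.le)) ?_
  have h : c⁻¹ • (c • x ⊓ c • y) ≤ x ⊓ y := by
    refine le_inf ?_ ?_
    · have := smul_le_smul_of_nonneg_left (inf_le_left : c • x ⊓ c • y ≤ c • x) (inv_pos.2 hc).le
      rwa [inv_smul_smul₀ hc.ne'] at this
    · have := smul_le_smul_of_nonneg_left (inf_le_right : c • x ⊓ c • y ≤ c • y) (inv_pos.2 hc).le
      rwa [inv_smul_smul₀ hc.ne'] at this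
  have := smul_le_smul_of_nonneg_left h hc.le
  rwa [smul_inv_smul₀ hc.ne'] at this

omit [IsOrderedAddMonoid F] in
theorem posPart_smul_of_pos {c : ℝ} (hc : 0 < c) (x : F) : (c • x)⁺ = c • x⁺ := by
  rw [posPart_def, posPart_def, smul_sup_of_pos hc, smul_zero]

omit [IsOrderedAddMonoid F] in
theorem abs_smul_of_pos {c : ℝ} (hc : 0 < c) (x : F) : |c • x| = c • |x| := by
  rw [abs, abs, smul_sup_of_pos hc, smul_neg]

omit [Module ℝ F] [IsOrderedModule ℝ F] in
theorem posPart_add_le (x y : F) : (x + y)⁺ ≤ x⁺ + y⁺ :=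
  sup_le (add_le_add (le_posPart x) (le_posPart y)) (add_nonneg (posPart_nonneg x) (posPart_nonneg y))

omit [Module ℝ F] [IsOrderedModule ℝ F] in
theorem add_inf_le_inf_add_inf {a b c : F} (ha : 0 ≤ a) (hb : 0 ≤ b) (hc : 0 ≤ c) :
    (a + b) ⊓ c ≤ a ⊓ c + b ⊓ c := by
  rw [add_inf, inf_add, inf_add]
  refine le_inf (le_inf inf_le_left ?_) (le_inf ?_ ?_)
  · exact inf_le_right.trans (le_add_of_nonneg_right hb)
  · exact inf_le_right.trans (le_add_of_nonneg_left ha)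
  · exact inf_le_right.trans (le_add_of_nonneg_left hc)

theorem smul_inf_eq_zero_of_inf_eq_zero {u v : F} (hu : 0 ≤ u) (hv : 0 ≤ v) (h : u ⊓ v = 0)
    {s : ℝ} (hs : 0 ≤ s) : (s • u) ⊓ v = 0 := by
  refine le_antisymm ?_ (le_inf (smul_nonneg hs hu) hv)
  -- Enlarging both entries to a common multiple reduces to scaling `u ⊓ v`.
  have hM : (0 : ℝ) < max s 1 := lt_max_of_lt_right one_pos
  calc (s • u) ⊓ v ≤ (max s 1 • u) ⊓ (max s 1 • v) := by
        refine inf_le_inf (smul_le_smul_of_nonneg_right (le_max_left _ _) hu) ?_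
        simpa using smul_le_smul_of_nonneg_right (le_max_right s 1) hv
    _ = 0 := by rw [← smul_inf_of_pos hM, h, smul_zero]

/-- Given disjoint positive `u` and `v`, a positive functional `φ` has a component that agrees with
`φ` at `u` and vanishes at `v`. -/
theorem exists_component_of_disjoint (φ : F →ₗ[ℝ] ℝ) (hφ : ∀ g, 0 ≤ g → 0 ≤ φ g) {u v : F}
    (hu : 0 ≤ u) (hv : 0 ≤ v) (huv : u ⊓ v = 0) :
    ∃ ψ : F →ₗ[ℝ] ℝ, (∀ g, 0 ≤ g → 0 ≤ ψ g) ∧ (∀ g, 0 ≤ g → ψ g ≤ φ g) ∧ ψ u = φ u ∧ ψ v = 0 := by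
  have mono : ∀ {a b : F}, a ≤ b → φ a ≤ φ b := fun {a b} h => by
    have := hφ (b - a) (sub_nonneg.2 h)
    rw [map_sub] at this
    linarith
  -- On positive `g` this is the classical formula for the component of `φ` on the band of `u`. Only
  -- sublinearity is checked; Hahn–Banach at `u` supplies linearity.
  let N : F → ℝ := fun g => ⨆ s : NNReal, φ (g⁺ ⊓ (s : ℝ) • u)
  have bdd : ∀ g : F, BddAbove (Set.range fun s : NNReal => φ (g⁺ ⊓ (s : ℝ) • u)) := fun g =>
    ⟨φ g⁺, by rintro _ ⟨s, rfl⟩; exact mono inf_le_left⟩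
  have le_N : ∀ (g : F) (s : ℝ), 0 ≤ s → φ (g⁺ ⊓ s • u) ≤ N g := fun g s hs =>
    le_ciSup (bdd g) ⟨s, hs⟩
  have N_le : ∀ g, N g ≤ φ g⁺ := fun g => ciSup_le fun s => mono inf_le_left
  have N_nonneg : ∀ g, 0 ≤ N g := fun g =>
    (hφ _ (le_inf (posPart_nonneg g) (by simp))).trans (le_N g 0 le_rfl)
  have N_hom_le : ∀ c : ℝ, 0 < c → ∀ g, N (c • g) ≤ c * N g := fun c hc g => ciSup_le fun s => by
    have h : (c • g)⁺ ⊓ (s : ℝ) • u = c • (g⁺ ⊓ (s / c : ℝ) • u) := by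
      rw [smul_inf_of_pos hc, posPart_smul_of_pos hc, smul_smul, mul_div_cancel₀ _ hc.ne']
    rw [h, map_smul, smul_eq_mul]
    exact mul_le_mul_of_nonneg_left (le_N g _ (div_nonneg s.2 hc.le)) hc.le
  have N_hom : ∀ c : ℝ, 0 < c → ∀ g, N (c • g) = c * N g := fun c hc g => by
    refine le_antisymm (N_hom_le c hc g) ?_
    have := N_hom_le c⁻¹ (inv_pos.2 hc) (c • g)
    rw [inv_smul_smul₀ hc.ne'] at this
    calc c * N g ≤ c * (c⁻¹ * N (c • g)) := mul_le_mul_of_nonneg_left this hc.le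
      _ = N (c • g) := mul_inv_cancel_left₀ hc.ne' _
  have N_add : ∀ g h, N (g + h) ≤ N g + N h := fun g h => ciSup_le fun s => by
    have hsu : 0 ≤ (s : ℝ) • u := smul_nonneg s.2 hu
    calc φ ((g + h)⁺ ⊓ (s : ℝ) • u) ≤ φ (g⁺ ⊓ (s : ℝ) • u + h⁺ ⊓ (s : ℝ) • u) :=
          mono ((inf_le_inf_right _ (posPart_add_le g h)).trans
            (add_inf_le_inf_add_inf (posPart_nonneg g) (posPart_nonneg h) hsu))
      _ ≤ N g + N h := by
          rw [map_add]
          exact add_le_add (le_N g s s.2) (le_N h s s.2)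
  obtain ⟨ψ, hψu, hψN⟩ := exists_linearMap_le_sublinear_eq N N_hom N_add N_nonneg u
  have ψ_nonneg : ∀ g, 0 ≤ g → 0 ≤ ψ g := fun g hg => by
    have h1 := (hψN (-g)).trans (N_le (-g))
    rw [posPart_eq_zero.2 (neg_nonpos.2 hg), map_zero, map_neg] at h1
    linarith
  refine ⟨ψ, ψ_nonneg, fun g hg => ?_, ?_, ?_⟩
  · simpa [posPart_of_nonneg hg] using (hψN g).trans (N_le g)
  · rw [hψu]
    refine le_antisymm (by simpa [posPart_of_nonneg hu] using N_le u) ?_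
    simpa [posPart_of_nonneg hu] using le_N u 1 zero_le_one
  · refine le_antisymm ((hψN v).trans (ciSup_le fun s => ?_)) (ψ_nonneg v hv)
    rw [posPart_of_nonneg hv, inf_comm, smul_inf_eq_zero_of_inf_eq_zero hu hv huv s.coe_nonneg,
      map_zero]

omit [IsOrderedModule ℝ F] in
theorem linearMap_eq_zero_of_nonneg {ψ : F →ₗ[ℝ] ℝ} (h : ∀ g, 0 ≤ g → ψ g = 0) : ψ = 0 := by
  ext g
  rw [← posPart_sub_negPart g, map_sub, h _ (posPart_nonneg g), h _ (negPart_nonneg g)]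
  simp

/-- If a positive functional `φ` dominated by an M-seminorm `ρ` attains `ρ` at `f`, then so does
every positive functional below `φ`, up to scaling. -/
theorem component_mul_le (ρ : F → ℝ) (ρ_hom : ∀ c : ℝ, 0 < c → ∀ x, ρ (c • x) = c * ρ x)
    (ρ_nonneg : ∀ x, 0 ≤ ρ x) (ρ_sup : ∀ f g, 0 ≤ f → 0 ≤ g → ρ (f ⊔ g) ≤ max (ρ f) (ρ g))
    {f : F} (hf : 0 ≤ f) (hρf : 0 < ρ f) {φ ψ : F →ₗ[ℝ] ℝ} (hφf : φ f = ρ f)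
    (hφρ : ∀ g, 0 ≤ g → φ g ≤ ρ g) (hψ : ∀ g, 0 ≤ g → 0 ≤ ψ g) (hψφ : ∀ g, 0 ≤ g → ψ g ≤ φ g)
    {g : F} (hg : 0 ≤ g) : ψ g * ρ f ≤ ψ f * ρ g := by
  -- `ρ g` may be zero, so the division uses any positive `c ≥ ρ g`.
  have key : ∀ c : ℝ, 0 < c → ρ g ≤ c → ψ g * ρ f ≤ ψ f * c := by
    intro c hc hgc
    have ht : 0 < ρ f / c := div_pos hρf hc
    set k := (ρ f / c) • g with hk
    have hk0 : 0 ≤ k := smul_nonneg ht.le hg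
    have hρk : ρ k ≤ ρ f := by
      rw [hk, ρ_hom _ ht, div_mul_eq_mul_div, div_le_iff₀ hc]
      exact mul_le_mul_of_nonneg_left hgc hρf.le
    -- `φ` cannot grow from `f` to `f ⊔ k`, since it already attains `ρ` at `f`. As `ψ ≤ φ` on `f ⊔
    -- k - f`, neither can `ψ`.
    have h1 : φ (f ⊔ k) ≤ φ f := by
      rw [hφf]
      exact (hφρ _ (hf.trans le_sup_left)).trans ((ρ_sup f k hf hk0).trans (max_le le_rfl hρk))
    have h2 := hψφ (f ⊔ k - f) (sub_nonneg.2 le_sup_left)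
    have h3 := hψ (f ⊔ k - k) (sub_nonneg.2 le_sup_right)
    simp only [map_sub] at h2 h3
    have h4 : ψ k ≤ ψ f := by linarith
    rw [hk, map_smul, smul_eq_mul, div_mul_eq_mul_div, div_le_iff₀ hc] at h4
    linarith
  refine le_of_forall_pos_le_add fun ε hε => ?_
  have hψf := hψ f hf
  have h := key (ρ g + ε / (ψ f + 1)) (add_pos_of_nonneg_of_pos (ρ_nonneg g) (by positivity))
    (le_add_of_nonneg_right (by positivity))
  have h5 : ψ f * (ε / (ψ f + 1)) ≤ ε := by
    rw [mul_div_assoc', div_le_iff₀ (by positivity)]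
    nlinarith
  linarith [mul_add (ψ f) (ρ g) (ε / (ψ f + 1))]

/-- The linear functionals dominated by `g ↦ ρ g⁺` and attaining `ρ` at `f`. -/
def supportingFunctionals (ρ : F → ℝ) (f : F) : Set (F → ℝ) :=
  {φ | IsLinearMap ℝ φ ∧ (∀ g, φ g ≤ ρ g⁺) ∧ φ f = ρ f}

omit [IsOrderedAddMonoid F] [IsOrderedModule ℝ F] in
theorem isCompact_supportingFunctionals (ρ : F → ℝ) (f : F) :
    IsCompact (supportingFunctionals ρ f) := by
  have hclosed : IsClosed (supportingFunctionals ρ f) := by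
    have h : supportingFunctionals ρ f =
        {φ : F → ℝ | ∀ x y, φ (x + y) = φ x + φ y} ∩ {φ | ∀ (c : ℝ) x, φ (c • x) = c • φ x} ∩
          ({φ | ∀ g, φ g ≤ ρ g⁺} ∩ {φ | φ f = ρ f}) := by
      ext φ
      exact ⟨fun h => ⟨⟨h.1.map_add, h.1.map_smul⟩, h.2⟩, fun h => ⟨⟨h.1.1, h.1.2⟩, h.2⟩⟩
    rw [h]
    simp only [Set.ofPred_forall]
    refine ((isClosed_iInter fun x => isClosed_iInter fun y => isClosed_eq ?_ ?_).inter
      (isClosed_iInter fun c => isClosed_iInter fun x => isClosed_eq ?_ ?_)).inter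
      ((isClosed_iInter fun g => isClosed_le ?_ ?_).inter (isClosed_eq ?_ ?_)) <;> fun_prop
  refine (isCompact_univ_pi fun g : F => isCompact_Icc (a := -ρ (-g)⁺) (b := ρ g⁺)).of_isClosed_subset
    hclosed fun φ hφ g _ => ⟨?_, hφ.2.1 g⟩
  have h1 := hφ.2.1 (-g)
  rw [hφ.1.map_neg] at h1
  linarith

/-- An M-seminorm is attained at each positive vector by a dominated lattice homomorphism. -/
theorem exists_latticeHom_eq (ρ : F → ℝ) (ρ_hom : ∀ c : ℝ, 0 < c → ∀ x, ρ (c • x) = c * ρ x)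
    (ρ_add : ∀ x y, ρ (x + y) ≤ ρ x + ρ y) (ρ_nonneg : ∀ x, 0 ≤ ρ x)
    (ρ_mono : ∀ x y, |x| ≤ |y| → ρ x ≤ ρ y)
    (ρ_sup : ∀ f g, 0 ≤ f → 0 ≤ g → ρ (f ⊔ g) ≤ max (ρ f) (ρ g)) {f : F} (hf : 0 ≤ f) :
    ∃ φ : F →ₗ[ℝ] ℝ, (∀ g, φ g⁺ = (φ g)⁺) ∧ (∀ g, φ g ≤ ρ g) ∧ φ f = ρ f := by
  have ρ0 : ρ 0 = 0 := by
    have := ρ_hom 2 two_pos 0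
    rw [smul_zero] at this
    linarith
  have ρ_mono' : ∀ x y : F, 0 ≤ x → x ≤ y → ρ x ≤ ρ y := fun x y hx hxy =>
    ρ_mono x y (by rwa [abs_of_nonneg hx, abs_of_nonneg (hx.trans hxy)])
  rcases (ρ_nonneg f).eq_or_lt with h0 | hρf
  · exact ⟨0, by simp, fun g => by simpa using ρ_nonneg g, by simpa using h0⟩
  obtain ⟨L, hLf, hL⟩ := exists_linearMap_le_sublinear_eq (fun g : F => ρ g⁺)
    (fun c hc x => by rw [posPart_smul_of_pos hc, ρ_hom c hc])
    (fun x y => (ρ_mono' _ _ (posPart_nonneg _) (posPart_add_le x y)).trans (ρ_add _ _))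
    (fun x => ρ_nonneg _) f
  obtain ⟨φ₀, hφ₀⟩ := (isCompact_supportingFunctionals ρ f).extremePoints_nonempty
    ⟨L, ⟨L.map_add, L.map_smul⟩, hL, by simpa [posPart_of_nonneg hf] using hLf⟩
  obtain ⟨⟨hlin, hle, hφf⟩, hext⟩ := mem_extremePoints_iff_left.1 hφ₀
  obtain ⟨φ, rfl⟩ : ∃ φ : F →ₗ[ℝ] ℝ, ⇑φ = φ₀ := ⟨hlin.mk' φ₀, rfl⟩
  have φ_nonneg : ∀ g, 0 ≤ g → 0 ≤ φ g := fun g hg => by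
    have h1 := hle (-g)
    rw [posPart_eq_zero.2 (neg_nonpos.2 hg), ρ0, map_neg] at h1
    linarith
  have φ_le : ∀ g, 0 ≤ g → φ g ≤ ρ g := fun g hg => by simpa [posPart_of_nonneg hg] using hle g
  have scaled_mem : ∀ ψ : F →ₗ[ℝ] ℝ, (∀ g, 0 ≤ g → 0 ≤ ψ g) → (∀ g, 0 ≤ g → ψ g ≤ φ g) →
      0 < ψ f → ⇑((ρ f / ψ f) • ψ) ∈ supportingFunctionals ρ f := by
    intro ψ h0 hψφ hψf
    refine ⟨⟨map_add _, map_smul _⟩, fun g => ?_, ?_⟩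
    · have h1 := component_mul_le ρ ρ_hom ρ_nonneg ρ_sup hf hρf hφf φ_le h0 hψφ (posPart_nonneg g)
      have h2 : ψ g ≤ ψ g⁺ := by
        have := h0 (g⁺ - g) (sub_nonneg.2 (le_posPart g))
        rw [map_sub] at this
        linarith
      rw [LinearMap.smul_apply, smul_eq_mul, div_mul_eq_mul_div, div_le_iff₀ hψf]
      nlinarith
    · rw [LinearMap.smul_apply, smul_eq_mul, div_mul_cancel₀ _ hψf.ne']
  have vanish : ∀ ψ : F →ₗ[ℝ] ℝ, (∀ g, 0 ≤ g → 0 ≤ ψ g) → (∀ g, 0 ≤ g → ψ g ≤ φ g) →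
      ψ f = 0 → ψ = 0 := by
    intro ψ h0 hψφ hψf
    refine linearMap_eq_zero_of_nonneg fun g hg => le_antisymm ?_ (h0 g hg)
    have h1 := component_mul_le ρ ρ_hom ρ_nonneg ρ_sup hf hρf hφf φ_le h0 hψφ hg
    rw [hψf, zero_mul] at h1
    exact nonpos_of_mul_nonpos_left h1 hρf
  have atom : ∀ ψ : F →ₗ[ℝ] ℝ, (∀ g, 0 ≤ g → 0 ≤ ψ g) → (∀ g, 0 ≤ g → ψ g ≤ φ g) →
      ∀ g, ψ g * ρ f = ψ f * φ g := by
    intro ψ h0 hψφ g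
    have h0' : ∀ g, 0 ≤ g → 0 ≤ (φ - ψ) g := fun g hg => sub_nonneg.2 (hψφ g hg)
    have hψφ' : ∀ g, 0 ≤ g → (φ - ψ) g ≤ φ g := fun g hg => sub_le_self _ (h0 g hg)
    rcases (h0 f hf).eq_or_lt with h1 | h1
    · simp [vanish ψ h0 hψφ h1.symm]
    rcases (h0' f hf).eq_or_lt with h2 | h2
    · have h3 := vanish _ h0' hψφ' h2.symm
      rw [sub_eq_zero] at h3
      rw [← h3, hφf, mul_comm]
    -- The weights `ψ f / ρ f` and `(φ - ψ) f / ρ f` sum to one because `φ f = ρ f`.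
    have hseg : ⇑φ ∈ openSegment ℝ ⇑((ρ f / ψ f) • ψ) ⇑((ρ f / (φ - ψ) f) • (φ - ψ)) := by
      refine ⟨ψ f / ρ f, (φ - ψ) f / ρ f, div_pos h1 hρf, div_pos h2 hρf, ?_, ?_⟩
      · rw [← add_div, div_eq_one_iff_eq hρf.ne', LinearMap.sub_apply, hφf]
        ring
      · ext x
        simp only [Pi.add_apply, Pi.smul_apply, LinearMap.smul_apply, smul_eq_mul]
        rw [← mul_assoc, ← mul_assoc, div_mul_div_cancel₀ hρf.ne', div_mul_div_cancel₀ hρf.ne',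
          div_self h1.ne', div_self h2.ne']
        simp
    have h4 := congrFun (hext _ (scaled_mem ψ h0 hψφ h1) _ (scaled_mem _ h0' hψφ' h2) hseg) g
    rw [LinearMap.smul_apply, smul_eq_mul, div_mul_eq_mul_div, div_eq_iff h1.ne'] at h4
    linarith
  refine ⟨φ, fun h => ?_, fun g => (hle g).trans (ρ_mono _ _ ?_), hφf⟩
  · obtain ⟨ψ, h0, hψφ, hu, hv⟩ := exists_component_of_disjoint φ φ_nonneg (posPart_nonneg h)
      (negPart_nonneg h) (posPart_inf_negPart_eq_zero h)
    have e1 := atom ψ h0 hψφ h⁺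
    have e2 := atom ψ h0 hψφ h⁻
    rw [hu] at e1
    rw [hv, zero_mul] at e2
    have hh : φ h = φ h⁺ - φ h⁻ := by rw [← map_sub, posPart_sub_negPart]
    rcases (φ_nonneg _ (posPart_nonneg h)).eq_or_lt with h1 | h1
    · rw [hh, ← h1, zero_sub, posPart_eq_zero.2]
      exact neg_nonpos.2 (φ_nonneg _ (negPart_nonneg h))
    · have hψf : ψ f ≠ 0 := fun h2 => by
        rw [h2, zero_mul] at e1
        exact (mul_pos h1 hρf).ne' e1
      have h3 : φ h⁻ = 0 := (mul_eq_zero.1 e2.symm).resolve_left hψf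
      rw [hh, h3, sub_zero, posPart_of_nonneg h1.le]
  · rw [abs_of_nonneg (posPart_nonneg g)]
    exact sup_le (le_abs_self g) (abs_nonneg g)

omit [IsOrderedModule ℝ F] in
theorem map_sup_of_map_posPart {φ : F →ₗ[ℝ] ℝ} (h : ∀ g, φ g⁺ = (φ g)⁺) (f g : F) :
    φ (f ⊔ g) = φ f ⊔ φ g := by
  rw [sup_eq_add_posPart_sub, sup_eq_add_posPart_sub, map_add, h, map_sub]

omit [IsOrderedModule ℝ F] in
theorem map_inf_of_map_posPart {φ : F →ₗ[ℝ] ℝ} (h : ∀ g, φ g⁺ = (φ g)⁺) (f g : F) :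
    φ (f ⊓ g) = φ f ⊓ φ g := by
  rw [inf_eq_sub_posPart_sub, inf_eq_sub_posPart_sub, map_sub, h, map_sub]

end VectorLattice

/-! ### Gauges of AM-sets and their compact polars -/

section Gauge

open scoped Pointwise

variable {F : Type*} [AddCommGroup F] [Module ℝ F] [Lattice F] [IsOrderedAddMonoid F]
  [IsOrderedModule ℝ F] {A : Set F}

omit [IsOrderedAddMonoid F] in
theorem mem_smul_of_isSolid
    (hA : LatticeOrderedAddCommGroup.IsSolid A) {b : ℝ} (hb : 0 < b) {x y : F} (hy : y ∈ b • A)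
    (hxy : |x| ≤ |y|) : x ∈ b • A := by
  rw [Set.mem_smul_set_iff_inv_smul_mem₀ hb.ne'] at hy ⊢
  refine hA hy ?_
  rw [abs_smul_of_pos (inv_pos.2 hb), abs_smul_of_pos (inv_pos.2 hb)]
  exact smul_le_smul_of_nonneg_left hxy (inv_pos.2 hb).le

omit [Module ℝ F] [IsOrderedModule ℝ F] in
theorem IsAMSet.abs_mem (hA : IsAMSet A) {f : F} (hf : f ∈ A) : |f| ∈ A :=
  hA.1 hf (abs_abs f).le

/-- A convex combination of `f` and `g` is dominated by `|f| ⊔ |g|`, which lies in `A`. -/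
theorem IsAMSet.convex (hA : IsAMSet A) : Convex ℝ A := by
  intro f hf g hg a b ha hb hab
  refine hA.1 (hA.2 (hA.abs_mem hf) (hA.abs_mem hg) (abs_nonneg f) (abs_nonneg g)) ?_
  have hfs : |f| ≤ |f| ⊔ |g| := le_sup_left
  have hgs : |g| ≤ |f| ⊔ |g| := le_sup_right
  rw [abs_of_nonneg ((abs_nonneg f).trans hfs)]
  have abs_smul_le : ∀ {c : ℝ} (_ : 0 ≤ c) {x : F} (_ : |x| ≤ |f| ⊔ |g|),
      |c • x| ≤ c • (|f| ⊔ |g|) := by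
    intro c hc x hx
    rcases hc.eq_or_lt with rfl | hc
    · simp
    · rw [abs_smul_of_pos hc]
      exact smul_le_smul_of_nonneg_left hx hc.le
  calc |a • f + b • g| ≤ |a • f| + |b • g| := abs_add_le _ _
    _ ≤ a • (|f| ⊔ |g|) + b • (|f| ⊔ |g|) := add_le_add (abs_smul_le ha hfs) (abs_smul_le hb hgs)
    _ = |f| ⊔ |g| := by rw [← add_smul, hab, one_smul]

omit [IsOrderedAddMonoid F] in
theorem IsAMSet.gauge_mono_abs (hA : IsAMSet A) (habs : Absorbent ℝ A) {x y : F}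
    (hxy : |x| ≤ |y|) : gauge A x ≤ gauge A y := by
  refine le_of_forall_gt_imp_ge_of_dense fun c hc => ?_
  obtain ⟨b, hb, hbc, hy⟩ := exists_lt_of_gauge_lt habs hc
  exact (gauge_le_of_mem hb.le (mem_smul_of_isSolid hA.1 hb hy hxy)).trans hbc.le

theorem IsAMSet.gauge_sup_le (hA : IsAMSet A) (habs : Absorbent ℝ A) {f g : F} (hf : 0 ≤ f)
    (hg : 0 ≤ g) : gauge A (f ⊔ g) ≤ max (gauge A f) (gauge A g) := by
  refine le_of_forall_gt_imp_ge_of_dense fun c hc => ?_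
  have mem : ∀ x : F, gauge A x < c → c⁻¹ • x ∈ A := by
    intro x hx
    obtain ⟨b, hb, hbc, hx⟩ := exists_lt_of_gauge_lt habs hx
    rw [Set.mem_smul_set_iff_inv_smul_mem₀ hb.ne'] at hx
    refine hA.1 hx ?_
    rw [abs_smul_of_pos (inv_pos.2 hb), abs_smul_of_pos (inv_pos.2 (hb.trans hbc))]
    exact smul_le_smul_of_nonneg_right (inv_anti₀ hb hbc.le) (abs_nonneg x)
  have hc0 : 0 < c := (gauge_nonneg f).trans_lt ((le_max_left _ _).trans_lt hc)
  have hc' := (inv_pos.2 hc0).le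
  refine gauge_le_of_mem hc0.le ((Set.mem_smul_set_iff_inv_smul_mem₀ hc0.ne' _ _).2 ?_)
  rw [smul_sup_of_pos (inv_pos.2 hc0)]
  exact hA.2 (mem f ((le_max_left _ _).trans_lt hc)) (mem g ((le_max_right _ _).trans_lt hc))
    (smul_nonneg hc' hf) (smul_nonneg hc' hg)

/-- The real lattice homomorphisms on `F` dominated by the gauge of `A`, with the topology of
pointwise convergence. -/
def polarLatticeHoms (A : Set F) : Set (F → ℝ) :=
  {φ | IsLinearMap ℝ φ ∧ ((∀ f g, φ (f ⊔ g) = φ f ⊔ φ g) ∧ ∀ f g, φ (f ⊓ g) = φ f ⊓ φ g) ∧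
    ∀ g, |φ g| ≤ gauge A g}

omit [IsOrderedAddMonoid F] [IsOrderedModule ℝ F] in
theorem isCompact_polarLatticeHoms (A : Set F) : IsCompact (polarLatticeHoms A) := by
  have hclosed : IsClosed (polarLatticeHoms A) := by
    have h : polarLatticeHoms A =
        ({φ : F → ℝ | ∀ x y, φ (x + y) = φ x + φ y} ∩ {φ | ∀ (c : ℝ) x, φ (c • x) = c • φ x}) ∩
          (({φ | ∀ f g, φ (f ⊔ g) = φ f ⊔ φ g} ∩ {φ | ∀ f g, φ (f ⊓ g) = φ f ⊓ φ g}) ∩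
            {φ | ∀ g, |φ g| ≤ gauge A g}) := by
      ext φ
      exact ⟨fun h => ⟨⟨h.1.map_add, h.1.map_smul⟩, h.2⟩, fun h => ⟨⟨h.1.1, h.1.2⟩, h.2⟩⟩
    rw [h]
    simp only [Set.ofPred_forall]
    refine ((isClosed_iInter fun x => isClosed_iInter fun y => isClosed_eq ?_ ?_).inter
      (isClosed_iInter fun c => isClosed_iInter fun x => isClosed_eq ?_ ?_)).inter
      (((isClosed_iInter fun x => isClosed_iInter fun y => isClosed_eq ?_ ?_).inter
      (isClosed_iInter fun x => isClosed_iInter fun y => isClosed_eq ?_ ?_)).inter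
      (isClosed_iInter fun g => isClosed_le ?_ ?_)) <;> fun_prop
  exact (isCompact_univ_pi fun g : F =>
    isCompact_Icc (a := -gauge A g) (b := gauge A g)).of_isClosed_subset
    hclosed fun φ hφ g _ => abs_le.1 (hφ.2.2 g)

theorem IsAMSet.exists_mem_polarLatticeHoms (hA : IsAMSet A) (habs : Absorbent ℝ A) (f : F) :
    ∃ φ ∈ polarLatticeHoms A, |φ f| = gauge A f := by
  obtain ⟨φ, hφ, hle, hf⟩ := exists_latticeHom_eq (gauge A)
    (fun c hc x => gauge_smul_of_nonneg hc.le x) (gauge_add_le hA.convex habs) gauge_nonneg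
    (fun x y => hA.gauge_mono_abs habs) (fun f g => hA.gauge_sup_le habs) (abs_nonneg f)
  have habs_eq : ∀ g, gauge A |g| = gauge A g := fun g =>
    le_antisymm (hA.gauge_mono_abs habs (abs_abs g).le) (hA.gauge_mono_abs habs (abs_abs g).ge)
  have hφabs : ∀ g, φ |g| = |φ g| := fun g => by
    rw [abs, abs, map_sup_of_map_posPart hφ, map_neg]
  refine ⟨φ, ⟨⟨map_add φ, map_smul φ⟩, ⟨map_sup_of_map_posPart hφ, map_inf_of_map_posPart hφ⟩,
    fun g => ?_⟩, ?_⟩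
  · rw [← hφabs, ← habs_eq]
    exact hle _
  · rw [← hφabs, hf, habs_eq]

variable [TopologicalSpace F]

omit [IsOrderedAddMonoid F] [IsOrderedModule ℝ F] in
-- Equicontinuity: `|φ f - φ₀ f₀|` is at most `gauge A (f - f₀) + |φ f₀ - φ₀ f₀|`.
theorem continuous_eval_polarLatticeHoms [IsTopologicalAddGroup F] [ContinuousSMul ℝ F]
    (hA : A ∈ 𝓝 (0 : F)) : Continuous fun p : polarLatticeHoms A × F => p.1.1 p.2 := by
  refine continuous_iff_continuousAt.2 fun ⟨φ₀, f₀⟩ => ?_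
  refine tendsto_iff_dist_tendsto_zero.2 ?_
  have h1 : Filter.Tendsto (fun p : polarLatticeHoms A × F => gauge A (p.2 - f₀))
      (𝓝 (φ₀, f₀)) (𝓝 0) := by
    have h := tendsto_gauge_nhds_zero hA
    refine h.comp ?_
    have : Continuous fun p : polarLatticeHoms A × F => p.2 - f₀ := by fun_prop
    simpa using this.tendsto (φ₀, f₀)
  have h2 : Filter.Tendsto (fun p : polarLatticeHoms A × F => dist (p.1.1 f₀) (φ₀.1 f₀))
      (𝓝 (φ₀, f₀)) (𝓝 0) := by
    have : Continuous fun p : polarLatticeHoms A × F => dist (p.1.1 f₀) (φ₀.1 f₀) := by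
      have : Continuous fun p : polarLatticeHoms A × F => p.1.1 f₀ :=
        (continuous_apply f₀).comp (continuous_subtype_val.comp continuous_fst)
      fun_prop
    simpa using this.tendsto (φ₀, f₀)
  refine squeeze_zero (fun _ => dist_nonneg) (fun p => ?_) (by simpa using h1.add h2)
  refine (dist_triangle _ (p.1.1 f₀) _).trans (add_le_add_left ?_ _)
  rw [Real.dist_eq, ← p.1.2.1.map_sub]
  exact p.1.2.2.2 _

omit [IsOrderedAddMonoid F] [IsOrderedModule ℝ F] in
/-- For a neighbourhood `A` of zero, the lattice homomorphisms dominated by the gauge of `A` form a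
compact set in the compact-open topology. -/
theorem exists_isCompact_polar [IsTopologicalAddGroup F] [ContinuousSMul ℝ F]
    (hA : A ∈ 𝓝 (0 : F)) : ∃ K : Set (contLatticeHoms F), IsCompact K ∧
      ∀ φ ∈ polarLatticeHoms A, ∃ x ∈ K, ∀ f, x.1 f = φ f := by
  -- Currying the jointly continuous evaluation upgrades pointwise convergence to the compact-open
  -- topology.
  let e : C(polarLatticeHoms A, C(F, ℝ)) :=
    ContinuousMap.curry ⟨_, continuous_eval_polarLatticeHoms hA⟩
  let e' : polarLatticeHoms A → contLatticeHoms F := fun φ => ⟨e φ, φ.2.1, φ.2.2.1⟩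
  have he' : Continuous e' := e.continuous.subtype_mk _
  have := isCompact_iff_compactSpace.1 (isCompact_polarLatticeHoms A)
  exact ⟨Set.range e', isCompact_range he', fun φ hφ => ⟨e' ⟨φ, hφ⟩, ⟨_, rfl⟩, fun _ => rfl⟩⟩

end Gauge

/-! ### The evaluation map is an embedding -/

section EvalMap

variable {F : Type*} [AddCommGroup F] [Module ℝ F] [Lattice F] [TopologicalSpace F]

/-- It suffices to test along maps `g` from compact Hausdorff spaces `K`. There `(k, x) ↦ x (g k)`
is jointly continuous, as evaluation on `C(K, ℝ) × K` is. -/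
theorem continuous_evalMap [CompactlyGeneratedSpace F] : Continuous (evalMap F) := by
  refine continuous_from_compactlyGeneratedSpace _ fun K _ _ _ g hg => ?_
  refine ContinuousMap.continuous_of_continuous_uncurry _ ?_
  have h : Continuous fun p : K × contLatticeHoms F =>
      (p.2.1.comp ⟨g, hg⟩ : C(K, ℝ)) p.1 := by
    have h1 : Continuous fun p : K × contLatticeHoms F => (p.2.1.comp ⟨g, hg⟩ : C(K, ℝ)) :=
      (ContinuousMap.continuous_precomp ⟨g, hg⟩).comp (continuous_subtype_val.comp continuous_snd)
    exact h1.eval continuous_fst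
  exact h

theorem isLinearMap_evalMap : IsLinearMap ℝ (evalMap F) :=
  ⟨fun f g => ContinuousMap.ext fun x => x.2.1.map_add f g,
    fun c f => ContinuousMap.ext fun x => x.2.1.map_smul c f⟩

theorem t35Space_contLatticeHoms : T35Space (contLatticeHoms F) :=
  have : T35Space C(F, ℝ) := {}
  inferInstanceAs (T35Space {x // x ∈ contLatticeHoms F})

theorem isEmbedding_evalMap [IsOrderedAddMonoid F] [IsOrderedModule ℝ F]
    (hAM : IsAMTopology F) [T2Space F] [CompactlyGeneratedSpace F] : IsEmbedding (evalMap F) := by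
  have := hAM.isTopologicalAddGroup
  have := hAM.continuousSMul
  suffices h : IsInducing ((isLinearMap_evalMap (F := F)).mk' (evalMap F)) from
    IsInducing.isEmbedding h
  rw [IsTopologicalAddGroup.isInducing_iff_nhds_zero]
  refine le_antisymm ?_ ?_
  · rw [← Filter.map_le_iff_le_comap, ← map_zero ((isLinearMap_evalMap (F := F)).mk' (evalMap F))]
    exact continuous_evalMap.tendsto 0
  · refine hAM.hasBasis.ge_iff.2 fun A ⟨hA, hAMA⟩ => ?_
    have habs : Absorbent ℝ A := absorbent_nhds_zero hA
    obtain ⟨K, hK, hpolar⟩ := exists_isCompact_polar hA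
    refine ⟨{j | Set.MapsTo j K (Metric.ball 0 1)},
      (ContinuousMap.isOpen_setOfPred_mapsTo hK Metric.isOpen_ball).mem_nhds
        fun x _ => Metric.mem_ball_self one_pos, fun f hf => ?_⟩
    obtain ⟨φ, hφ, hφf⟩ := hAMA.exists_mem_polarLatticeHoms habs f
    obtain ⟨x, hx, hxφ⟩ := hpolar φ hφ
    refine setOfPred_gauge_lt_one_subset_self hAMA.convex (mem_of_mem_nhds hA) habs ?_
    have h := hf hx
    rw [mem_ball_zero_iff, Real.norm_eq_abs] at h
    change gauge A f < 1
    rw [← hφf, ← hxφ]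
    exact h

end EvalMap

theorem mainTheorem10 (F : Type*) [AddCommGroup F] [Module ℝ F] [Lattice F]
    [IsOrderedAddMonoid F] [IsOrderedModule ℝ F] [TopologicalSpace F]
    (hAM : IsAMTopology F) [T2Space F] [CompactlyGeneratedSpace F] :
    T35Space (contLatticeHoms F) ∧
      IsLinearMap ℝ (evalMap F) ∧
      (∀ f g : F, evalMap F (f ⊔ g) = evalMap F f ⊔ evalMap F g) ∧
      (∀ f g : F, evalMap F (f ⊓ g) = evalMap F f ⊓ evalMap F g) ∧
      IsEmbedding (evalMap F) :=
  ⟨t35Space_contLatticeHoms, isLinearMap_evalMap, fun f g => ContinuousMap.ext fun x => x.2.2.1 f g,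
    fun f g => ContinuousMap.ext fun x => x.2.2.2 f g, isEmbedding_evalMap hAM⟩
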